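/- Let $d\ge 0$, $D\ge 1$ be integers. For $k\times k$ complex matrices $\omega,A_1,\dots,A_d$ let $$|\psi(\omega,A,n)\rangle=\sum_{i_1,\dots,i_n=1}^d \mathrm{tr}(\omega A_{i_1}\cdots A_{i_n})\,|i_1,\dots,i_n\rangle\in(\mathbb C^d)^{\otimes n}$$ be the $n$-site matrix product state (MPS) of bond dimension $k$ with boundary matrix $\omega$ and matrices $A=(A_1,\dots,A_d)$. A polynomial $P(X)$ with complex coefficients in noncommuting variables $X_1,\dots,X_d$ is a matrix polynomial identity (MPI) for dimension $D$ if it vanishes on all $d$-tuples of $k\times k$ complex matrices, for every $k\le D$; it is central for dimension $D$ if its value at every $d$-tuple of $D\times D$ complex matrices is a scalar multiple of the identity. Let $\mathcal Q_{D,m}$ be the quotient of the vector space of homogeneous central polynomials of degree $m$ for dimension $D$ by the subspace of homogeneous MPIs of degree $m$ for dimension $D$. For a homogeneous $P(X)=\sum p_{i_1,\dots,i_m}X_{i_1}\cdots X_{i_m}$ put $|P(X)\rangle=\sum p_{i_1,\dots,i_m}^{*}\,|i_1,\dots,i_m\rangle$. A cut-and-glue operator on $m$ sites for bond dimension $D$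 is an operator $$C=\sum_{i=1}^N|\varphi_i\rangle\langle P_i(X)|$$ on $(\mathbb C^d)^{\otimes m}$, where $P_1,\dots,P_N$ are homogeneous central polynomials of degree $m$ for dimension $D$ whose classes form a basis of $\mathcal Q_{D,m}$, and $\{\varphi_i\}_{i=1}^N$ is any orthonormal set in $(\mathbb C^d)^{\otimes m}$. Then: 1. For every $m\ge 0$ such $P_i$, $\varphi_i$ exist (in particular $\mathcal Q_{D,m}$ is finite-dimensional, of dimension at most $d^m$). 2. Let $C$ be any such operator, $k\le D$, and $A=(A_1,\dots,A_d)$ a tuple of $k\times k$ matrices. There are scalars $p_i(A)$, depending only on $A$ and the $P_i$, with $P_i(A)=p_i(A)\mathbb I$, such that for all $s,r\ge 0$ and every $k\times k$ matrix $\omega$, with $n=s+m+r$, applying $C$ to particles $s+1,\dots,s+m$ of $|\psi(\omega,A,n)\rangle$ gives the (unnormalized) product state in which the particles $s+1,\dots,s+m$ are in the pure state $\sum_i p_i(A)|\varphi_i\rangle$ and the remaining $n-m$ particles, in their order, are in the MPS $|\psi(\omega,A,n-m)\rangle$ with the same $\omega$ and $A$. 3. If $m\ge 1$ and $\mathcal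 Q_{D,m}\ne 0$, then for every such $C$ and all $s,r\ge 0$ there are $D\times D$ matrices $\omega,A_1,\dots,A_d$ such that the result of applying $C$ to particles $s+1,\dots,s+m$ of $|\psi(\omega,A,s+m+r)\rangle$ is not zero. 4. If $d\ge 2$, there is $m\ge 1$ with $\mathcal Q_{D,m}\neq 0$; that is, homogeneous central polynomials of positive degree for dimension $D$ that are not MPIs exist. -/

import Mathlib

noncomputable section

namespace CutGlue

/-- The space `(ℂ^d)^{⊗ n}` of `n` particles of local dimension `d`, in the product basis
`|i_1, …, i_n⟩`, with its standard inner product. -/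
abbrev Chain (d n : ℕ) : Type := EuclideanSpace ℂ (Fin n → Fin d)

/-- The matrix product state
`∑ tr(ω A_{i_1} ⋯ A_{i_n}) |i_1, …, i_n⟩` with boundary matrix `ω`. -/
def mps {d k : ℕ} (ω : Matrix (Fin k) (Fin k) ℂ) (A : Fin d → Matrix (Fin k) (Fin k) ℂ)
    (n : ℕ) : Chain d n :=
  WithLp.toLp 2 fun i => (ω * (List.ofFn fun j => A (i j)).prod).trace

/-- Polynomials with complex coefficients in `d` noncommuting variables. -/
abbrev NCPoly (d : ℕ) : Type := FreeAlgebra ℂ (Fin d)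

/-- The coefficient of the word `X_{w_1} X_{w_2} ⋯` in a noncommutative polynomial. -/
def coeff {d : ℕ} (w : List (Fin d)) : NCPoly d →ₗ[ℂ] ℂ where
  toFun P := (FreeAlgebra.equivMonoidAlgebraFreeMonoid P : MonoidAlgebra ℂ (FreeMonoid (Fin d))).coeff
    (FreeMonoid.ofList w)
  map_add' P Q := by simp
  map_smul' c P := by simp

/-- Evaluation of a noncommutative polynomial at a tuple of `k × k` matrices. -/
abbrev evalAt {d k : ℕ} (A : Fin d → Matrix (Fin k) (Fin k) ℂ) :
    NCPoly d →ₐ[ℂ] Matrix (Fin k) (Fin k) ℂ :=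
  FreeAlgebra.lift ℂ A

/-- `P` is homogeneous of degree `m` (the zero polynomial is, for every `m`). -/
def IsHomogeneous {d : ℕ} (m : ℕ) (P : NCPoly d) : Prop :=
  ∀ w : List (Fin d), w.length ≠ m → coeff w P = 0

/-- `P` is a matrix polynomial identity for dimension `D`. -/
def IsMPI {d : ℕ} (D : ℕ) (P : NCPoly d) : Prop :=
  ∀ k ≤ D, ∀ A : Fin d → Matrix (Fin k) (Fin k) ℂ, evalAt A P = 0

/-- `P` is a central polynomial for dimension `D`. -/
def IsCentral {d : ℕ} (D : ℕ) (P : NCPoly d) : Prop :=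
  ∀ A : Fin d → Matrix (Fin D) (Fin D) ℂ, ∃ c : ℂ, evalAt A P = c • 1

/-- The space of homogeneous matrix polynomial identities of degree `m` for dimension `D`. -/
def mpiSpace (d D m : ℕ) : Submodule ℂ (NCPoly d) where
  carrier := {P | IsHomogeneous m P ∧ IsMPI D P}
  add_mem' := by
    rintro P Q ⟨hP, hP'⟩ ⟨hQ, hQ'⟩
    exact ⟨fun w hw => by rw [map_add, hP w hw, hQ w hw, add_zero],
      fun k hk A => by rw [map_add, hP' k hk A, hQ' k hk A, add_zero]⟩
  zero_mem' := ⟨fun w _ => map_zero _, fun k _ A => map_zero _⟩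
  smul_mem' := by
    rintro c P ⟨hP, hP'⟩
    exact ⟨fun w hw => by rw [map_smul, hP w hw, smul_zero],
      fun k hk A => by rw [map_smul, hP' k hk A, smul_zero]⟩

/-- The space of homogeneous central polynomials of degree `m` for dimension `D`. -/
def centralSpace (d D m : ℕ) : Submodule ℂ (NCPoly d) where
  carrier := {P | IsHomogeneous m P ∧ IsCentral D P}
  add_mem' := by
    rintro P Q ⟨hP, hP'⟩ ⟨hQ, hQ'⟩
    refine ⟨fun w hw => by rw [map_add, hP w hw, hQ w hw, add_zero], fun A => ?_⟩
    obtain ⟨a, ha⟩ := hP' A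
    obtain ⟨b, hb⟩ := hQ' A
    exact ⟨a + b, by rw [map_add, ha, hb, add_smul]⟩
  zero_mem' := ⟨fun w _ => map_zero _, fun A => ⟨0, by rw [map_zero, zero_smul]⟩⟩
  smul_mem' := by
    rintro c P ⟨hP, hP'⟩
    refine ⟨fun w hw => by rw [map_smul, hP w hw, smul_zero], fun A => ?_⟩
    obtain ⟨a, ha⟩ := hP' A
    exact ⟨c * a, by rw [map_smul, ha, smul_smul]⟩

/-- The quotient `𝒬_{D,m}` of the homogeneous central polynomials of degree `m` by those that are
matrix polynomial identities (for dimension `D`). -/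
abbrev CentralQuotient (d D m : ℕ) : Type :=
  centralSpace d D m ⧸ (mpiSpace d D m).submoduleOf (centralSpace d D m)

/-- The `m`-particle vector `|P(X)⟩ = ∑ p*_{i_1, …, i_m} |i_1, …, i_m⟩`. -/
def ket {d : ℕ} (m : ℕ) (P : NCPoly d) : Chain d m :=
  WithLp.toLp 2 fun i => star (coeff (List.ofFn i) P)

/-- The choices in the construction of a cut-and-glue operator: homogeneous central polynomials
`P_i` of degree `m` whose classes form a basis of `𝒬_{D,m}`, and an orthonormal family `φ_i` of
`m`-particle states. -/
structure CutGlueData (d D m : ℕ) where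
  /-- the number of basis elements -/
  N : ℕ
  /-- the basis of the quotient -/
  basis : Module.Basis (Fin N) ℂ (CentralQuotient d D m)
  /-- central polynomials representing the basis elements -/
  P : Fin N → centralSpace d D m
  mk_P : ∀ i, Submodule.Quotient.mk (P i) = basis i
  /-- the orthonormal states -/
  φ : Fin N → Chain d m
  orthonormal : Orthonormal ℂ φ

/-- The cut-and-glue operator `C = ∑_i |φ_i⟩⟨P_i(X)|` on `m` particles. -/
def CutGlueData.op {d D m : ℕ} (c : CutGlueData d D m) : Chain d m →ₗ[ℂ] Chain d m :=
  ∑ i, (InnerProductSpace.rankOne ℂ (c.φ i) (ket m (c.P i : NCPoly d))).toLinearMap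

section Positions

variable {α : Type*} {s m r : ℕ}

/-- The labels of the first `s` sites of `s + m + r`. -/
def leftPart (i : Fin (s + m + r) → α) : Fin s → α :=
  fun j => i (Fin.castAdd r (Fin.castAdd m j))

/-- The labels of the sites `s + 1, …, s + m` of `s + m + r`. -/
def midPart (i : Fin (s + m + r) → α) : Fin m → α :=
  fun j => i (Fin.castAdd r (Fin.natAdd s j))

/-- The labels of the last `r` sites of `s + m + r`. -/
def rightPart (i : Fin (s + m + r) → α) : Fin r → α :=
  fun j => i (Fin.natAdd (s + m) j)

end Positions

/-- The operator `1^{⊗ s} ⊗ C ⊗ 1^{⊗ r}`: the `m`-particle operator `C` acting on the particles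
`s + 1, …, s + m` of a chain of `s + m + r` particles. -/
def actAt {d m : ℕ} (s r : ℕ) (C : Chain d m →ₗ[ℂ] Chain d m) :
    Chain d (s + m + r) →ₗ[ℂ] Chain d (s + m + r) where
  toFun ψ := WithLp.toLp 2 fun i =>
    C (WithLp.toLp 2 fun v => ψ (Fin.append (Fin.append (leftPart i) v) (rightPart i))) (midPart i)
  map_add' ψ χ := by
    ext i
    exact congrArg (fun x : Chain d m => x (midPart i)) (map_add C
      (WithLp.toLp 2 fun v => ψ (Fin.append (Fin.append (leftPart i) v) (rightPart i)))
      (WithLp.toLp 2 fun v => χ (Fin.append (Fin.append (leftPart i) v) (rightPart i))))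
  map_smul' a ψ := by
    ext i
    exact congrArg (fun x : Chain d m => x (midPart i)) (map_smul C a
      (WithLp.toLp 2 fun v => ψ (Fin.append (Fin.append (leftPart i) v) (rightPart i))))

/-- The product state of `s + m + r` particles in which the particles `s + 1, …, s + m` are in the
pure state `χ` and the remaining ones, in their order, in the state `ψ`. -/
def insertState {d m : ℕ} (s r : ℕ) (χ : Chain d m) (ψ : Chain d (s + r)) :
    Chain d (s + m + r) :=
  WithLp.toLp 2 fun i => χ (midPart i) * ψ (Fin.append (leftPart i) (rightPart i))

end CutGlue

end

namespace CutGlue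

open Matrix Equiv

/-! ### Words and coefficients -/

/-! Cutting and gluing is linearity of the trace: with `L` and `R` the matrix products to the left
and right of the block, pairing the block with `P` turns the amplitudes into `tr(ω L P(A) R)`, and
`P(A) = p • 1` leaves `p * tr(ω L R)` (`actAt_op_mps`). Sizes `k < D` reduce to `D` by zero padding.

For nonvanishing, a basis representative `P_j` is nonzero at some tuple. In positive degree that
tuple must have size `D` (`evalAt_eq_zero_of_lt`), so `P_j(A)` is an invertible scalar. Hence `A` is
not nilpotent, and words of every length survive (`exists_word_ne_zero`).

Existence in positive degree rests on `doubleVandermonde`. For diagonal `X`, an entry is a sum over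
paths on `D` vertices with `D` steps, weighted by entries of `Y` and by the Vandermonde determinants
of the first `D` and the last `D` vertices. Only closed Hamiltonian cycles survive, so off-diagonal
entries vanish; rotating cycles shows that the diagonal entries agree
(`evalAt_doubleVandermonde_of_diagonal`). Conjugation and density of matrices with separable
characteristic polynomial extend centrality to every `X`. -/

/-- The monomial `X_{w_1} X_{w_2} ⋯` of a word. -/
noncomputable def monomial {d : ℕ} (w : List (Fin d)) : NCPoly d :=
  (w.map (FreeAlgebra.ι ℂ)).prod

lemma equiv_monomial {d : ℕ} (w : List (Fin d)) :
    FreeAlgebra.equivMonoidAlgebraFreeMonoid (monomial w) =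
      (MonoidAlgebra.single (FreeMonoid.ofList w) 1 : MonoidAlgebra ℂ (FreeMonoid (Fin d))) := by
  induction w with
  | nil => simp [monomial, MonoidAlgebra.one_def]
  | cons a w ih =>
    have h : monomial (a :: w) = FreeAlgebra.ι ℂ a * monomial w := by simp [monomial]
    rw [h, map_mul, ih, FreeMonoid.ofList_cons]
    simp [FreeAlgebra.equivMonoidAlgebraFreeMonoid, MonoidAlgebra.of_apply]

lemma coeff_monomial {d : ℕ} (u w : List (Fin d)) :
    coeff w (monomial u) = if u = w then 1 else 0 := by
  classical
  change (FreeAlgebra.equivMonoidAlgebraFreeMonoid (monomial u) :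
    MonoidAlgebra ℂ (FreeMonoid (Fin d))).coeff (FreeMonoid.ofList w) = _
  rw [equiv_monomial, MonoidAlgebra.coeff_single, Finsupp.single_apply]
  simp

lemma coeff_ext {d : ℕ} {P Q : NCPoly d} (h : ∀ w, coeff w P = coeff w Q) : P = Q := by
  apply FreeAlgebra.equivMonoidAlgebraFreeMonoid.injective
  apply MonoidAlgebra.coeff_injective
  ext w
  exact h (FreeMonoid.toList w)

lemma isHomogeneous_monomial {d : ℕ} (w : List (Fin d)) :
    IsHomogeneous w.length (monomial w) := by
  intro u hu
  rw [coeff_monomial, if_neg]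
  rintro rfl
  exact hu rfl

lemma IsHomogeneous.eq_sum {d m : ℕ} {P : NCPoly d} (hP : IsHomogeneous m P) :
    P = ∑ i : Fin m → Fin d, coeff (List.ofFn i) P • monomial (List.ofFn i) := by
  apply coeff_ext
  intro w
  simp only [map_sum, map_smul, coeff_monomial, smul_eq_mul, mul_ite, mul_one, mul_zero]
  by_cases hw : w.length = m
  · subst hw
    rw [Finset.sum_eq_single w.get]
    · simp
    · intro i _ hi
      rw [if_neg]
      intro h
      apply hi
      apply List.ofFn_injective
      simpa using h
    · simp
  · rw [hP w hw, Finset.sum_eq_zero]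
    intro i _
    rw [if_neg]
    rintro rfl
    simp at hw

lemma evalAt_monomial {d k : ℕ} (A : Fin d → Matrix (Fin k) (Fin k) ℂ) (w : List (Fin d)) :
    evalAt A (monomial w) = (w.map A).prod := by
  simp [monomial, map_list_prod, Function.comp_def]

lemma IsHomogeneous.evalAt_eq_sum {d m k : ℕ} {P : NCPoly d} (hP : IsHomogeneous m P)
    (A : Fin d → Matrix (Fin k) (Fin k) ℂ) :
    evalAt A P = ∑ i : Fin m → Fin d,
      coeff (List.ofFn i) P • (List.ofFn fun j => A (i j)).prod := by
  conv_lhs => rw [hP.eq_sum]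
  simp only [map_sum, map_smul, evalAt_monomial, List.map_ofFn]
  rfl

/-! ### Intertwiners and smaller matrices -/

/-- `S` may be rectangular or singular: it serves for padding, for a coordinate functional and for a
change of basis. -/
lemma mul_evalAt_of_intertwine {d k l : ℕ} {A : Fin d → Matrix (Fin k) (Fin k) ℂ}
    {B : Fin d → Matrix (Fin l) (Fin l) ℂ} {S : Matrix (Fin l) (Fin k) ℂ}
    (h : ∀ i, S * A i = B i * S) (P : NCPoly d) : S * evalAt A P = evalAt B P * S := by
  induction P using FreeAlgebra.induction with
  | grade0 r => simp [Algebra.algebraMap_eq_smul_one]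
  | grade1 x => simpa using h x
  | mul a b ha hb => rw [map_mul, map_mul, ← Matrix.mul_assoc, ha, Matrix.mul_assoc, hb,
      Matrix.mul_assoc]
  | add a b ha hb => rw [map_add, map_add, Matrix.mul_add, ha, hb, Matrix.add_mul]

/-- The inclusion of the first `k` coordinates into `D` coordinates. -/
def inclusionMatrix (k D : ℕ) : Matrix (Fin D) (Fin k) ℂ :=
  Matrix.of fun i j => if i.val = j.val then 1 else 0

lemma transpose_mul_inclusionMatrix {k D : ℕ} (h : k ≤ D) :
    (inclusionMatrix k D)ᵀ * inclusionMatrix k D = 1 := by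
  ext i j
  rw [Matrix.mul_apply, Finset.sum_eq_single (Fin.castLE h i)]
  · simp [inclusionMatrix, Matrix.one_apply, Fin.ext_iff]
  · intro b _ hb
    have : b.val ≠ i.val := fun h' => hb (Fin.ext h')
    simp [inclusionMatrix, this]
  · simp

lemma inclusionMatrix_intertwine {d k D : ℕ} (h : k ≤ D) (A : Fin d → Matrix (Fin k) (Fin k) ℂ)
    (P : NCPoly d) :
    inclusionMatrix k D * evalAt A P =
      evalAt (fun i => inclusionMatrix k D * A i * (inclusionMatrix k D)ᵀ) P *
        inclusionMatrix k D := by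
  apply mul_evalAt_of_intertwine
  intro i
  rw [Matrix.mul_assoc _ _ (inclusionMatrix k D), transpose_mul_inclusionMatrix h, Matrix.mul_one]

lemma IsCentral.evalAt_eq_smul {d k D : ℕ} {P : NCPoly d} (hP : IsCentral D P) (h : k ≤ D)
    (A : Fin d → Matrix (Fin k) (Fin k) ℂ) : ∃ c : ℂ, evalAt A P = c • 1 := by
  obtain ⟨c, hc⟩ := hP fun i => inclusionMatrix k D * A i * (inclusionMatrix k D)ᵀ
  refine ⟨c, ?_⟩
  have := congrArg ((inclusionMatrix k D)ᵀ * ·) (inclusionMatrix_intertwine h A P)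
  simpa [hc, ← Matrix.mul_assoc, transpose_mul_inclusionMatrix h] using this

lemma IsHomogeneous.evalAt_zero {d m k : ℕ} {P : NCPoly d} (hP : IsHomogeneous m P) (hm : 1 ≤ m) :
    evalAt (fun _ => (0 : Matrix (Fin k) (Fin k) ℂ)) P = 0 := by
  obtain ⟨m, rfl⟩ := Nat.exists_eq_add_of_le' hm
  rw [hP.evalAt_eq_sum]
  simp [List.ofFn_succ]

/-- Padding `A` with zeros to size `D` gives a scalar matrix whose value can be read off at a padded
coordinate, where a polynomial without constant term gives `0`. -/
lemma evalAt_eq_zero_of_lt {d m k D : ℕ} {P : NCPoly d} (hm : 1 ≤ m) (hP : IsHomogeneous m P)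
    (hP' : IsCentral D P) (h : k < D) (A : Fin d → Matrix (Fin k) (Fin k) ℂ) :
    evalAt A P = 0 := by
  obtain ⟨c, hc⟩ := hP' fun i => inclusionMatrix k D * A i * (inclusionMatrix k D)ᵀ
  -- The functional of coordinate `k`, the first padded one, intertwines the padded tuple with the
  -- zero tuple of size one.
  let T : Matrix (Fin 1) (Fin D) ℂ := Matrix.of fun _ j => if j = ⟨k, h⟩ then 1 else 0
  have hT : T * inclusionMatrix k D = 0 := by
    ext i j
    rw [Matrix.mul_apply, Finset.sum_eq_single ⟨k, h⟩]
    · simp [inclusionMatrix, j.2.ne']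
    · intro b _ hb
      simp [T, hb]
    · simp
  have h1 : T * evalAt (fun i => inclusionMatrix k D * A i * (inclusionMatrix k D)ᵀ) P =
      evalAt (fun _ => (0 : Matrix (Fin 1) (Fin 1) ℂ)) P * T := by
    apply mul_evalAt_of_intertwine
    intro i
    rw [← Matrix.mul_assoc, ← Matrix.mul_assoc, hT, Matrix.zero_mul, Matrix.zero_mul,
      Matrix.zero_mul]
  rw [hP.evalAt_zero hm, hc] at h1
  have hc0 : c = 0 := by
    have := congrFun (congrFun h1 0) ⟨k, h⟩
    simpa [T] using this
  have := congrArg ((inclusionMatrix k D)ᵀ * ·) (inclusionMatrix_intertwine h.le A P)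
  simpa [hc, hc0, ← Matrix.mul_assoc, transpose_mul_inclusionMatrix h.le] using this

/-! ### Existence of cut-and-glue operators -/

/-- The coefficient vector of a homogeneous central polynomial. -/
noncomputable def coeffVector (d D m : ℕ) : centralSpace d D m →ₗ[ℂ] ((Fin m → Fin d) → ℂ) :=
  LinearMap.pi fun i => (coeff (List.ofFn i)).comp (centralSpace d D m).subtype

lemma coeffVector_injective (d D m : ℕ) : Function.Injective (coeffVector d D m) := by
  rw [← LinearMap.ker_eq_bot, LinearMap.ker_eq_bot']
  intro P hP
  apply Subtype.ext
  rw [P.2.1.eq_sum]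
  apply Finset.sum_eq_zero
  intro i _
  have : coeff (List.ofFn i) (P : NCPoly d) = 0 := congrFun hP i
  rw [this, zero_smul]

/-- A homogeneous polynomial is determined by its `d ^ m` coefficients, so the quotient is no larger
than the chain space and an orthonormal family of the required size fits. -/
lemma nonempty_cutGlueData (d D m : ℕ) : Nonempty (CutGlueData d D m) := by
  have hfin : Module.Finite ℂ (centralSpace d D m) :=
    Module.Finite.of_injective _ (coeffVector_injective d D m)
  have hle : Module.finrank ℂ (CentralQuotient d D m) ≤ Module.finrank ℂ (Chain d m) := by
    refine (Submodule.finrank_quotient_le _).trans ?_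
    refine (LinearMap.finrank_le_finrank_of_injective (coeffVector_injective d D m)).trans ?_
    simp
  let b := Module.finBasis ℂ (CentralQuotient d D m)
  choose P hP using fun i => Submodule.Quotient.mk_surjective _ (b i)
  exact ⟨{
    N := _
    basis := b
    P := P
    mk_P := hP
    φ := fun i => stdOrthonormalBasis ℂ (Chain d m) (Fin.castLE hle i)
    orthonormal := (stdOrthonormalBasis ℂ (Chain d m)).orthonormal.comp _
      (Fin.castLE_injective hle) }⟩

/-! ### Action on matrix product states -/

/-- The conjugation in `ket` cancels the one in the bra, so the pairing uses the coefficients of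
`P_i` themselves. -/
lemma CutGlueData.op_apply {d D m : ℕ} (c : CutGlueData d D m) (ψ : Chain d m) :
    c.op ψ = ∑ i, (∑ v, coeff (List.ofFn v) (c.P i : NCPoly d) * ψ v) • c.φ i := by
  simp only [CutGlueData.op, LinearMap.sum_apply]
  refine Finset.sum_congr rfl fun i _ => ?_
  simp [ket, PiLp.inner_apply, mul_comm]

lemma ofFn_append_append {α : Type*} {s m r : ℕ} (f : Fin s → α) (v : Fin m → α)
    (g : Fin r → α) : List.ofFn (Fin.append (Fin.append f v) g) =
      List.ofFn f ++ List.ofFn v ++ List.ofFn g := by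
  simp [List.ofFn_fin_append]

lemma mps_apply {d k n : ℕ} (ω : Matrix (Fin k) (Fin k) ℂ)
    (A : Fin d → Matrix (Fin k) (Fin k) ℂ) (i : Fin n → Fin d) :
    mps ω A n i = (ω * ((List.ofFn i).map A).prod).trace := by
  simp [mps, List.map_ofFn, Function.comp_def]

lemma actAt_op_mps {d D m k : ℕ} (c : CutGlueData d D m) (A : Fin d → Matrix (Fin k) (Fin k) ℂ)
    (p : Fin c.N → ℂ) (hp : ∀ i, evalAt A (c.P i : NCPoly d) = p i • 1) (s r : ℕ)
    (ω : Matrix (Fin k) (Fin k) ℂ) :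
    actAt s r c.op (mps ω A (s + m + r)) =
      insertState s r (∑ i, p i • c.φ i) (mps ω A (s + r)) := by
  ext i
  change c.op _ (midPart i) = (∑ j, p j • c.φ j : Chain d m) (midPart i) *
    mps ω A (s + r) (Fin.append (leftPart i) (rightPart i))
  rw [c.op_apply]
  simp only [WithLp.ofLp_sum, WithLp.ofLp_smul, Finset.sum_apply, Pi.smul_apply, smul_eq_mul,
    Finset.sum_mul]
  refine Finset.sum_congr rfl fun j _ => ?_
  have key : ∑ v : Fin m → Fin d, coeff (List.ofFn v) (c.P j : NCPoly d) *
      mps ω A (s + m + r) (Fin.append (Fin.append (leftPart i) v) (rightPart i)) =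
      p j * mps ω A (s + r) (Fin.append (leftPart i) (rightPart i)) := by
    set L := ((List.ofFn (leftPart i)).map A).prod with hL
    set R := ((List.ofFn (rightPart i)).map A).prod with hR
    have h1 : mps ω A (s + r) (Fin.append (leftPart i) (rightPart i)) = (ω * (L * R)).trace := by
      rw [mps_apply, List.ofFn_fin_append]
      simp [hL, hR]
    have h2 : ∀ v : Fin m → Fin d,
        mps ω A (s + m + r) (Fin.append (Fin.append (leftPart i) v) (rightPart i)) =
          (ω * (L * (List.ofFn fun j => A (v j)).prod * R)).trace := by
      intro v
      rw [mps_apply, ofFn_append_append]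
      simp [hL, hR, List.map_ofFn, Function.comp_def, Matrix.mul_assoc]
    have h3 : ω * (L * evalAt A (c.P j : NCPoly d) * R) = p j • (ω * (L * R)) := by
      rw [hp j]; simp
    rw [h1, ← smul_eq_mul, ← Matrix.trace_smul, ← h3, (c.P j).2.1.evalAt_eq_sum A]
    simp only [h2, Matrix.mul_sum, Matrix.sum_mul, Matrix.trace_sum, Matrix.mul_smul,
      Matrix.smul_mul, Matrix.trace_smul, smul_eq_mul]
  rw [← Finset.sum_mul, key]
  ring

/-! ### Nonvanishing -/

/-- If all words of length `n` vanished at `A`, so would all longer ones. But `w(A) * P(A) = p •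
w(A)` shows that a nonzero word always has a nonzero extension by `m ≥ 1` letters. -/
lemma exists_word_ne_zero {d k m : ℕ} {P : NCPoly d} (hP : IsHomogeneous m P) (hm : 1 ≤ m)
    {A : Fin d → Matrix (Fin k) (Fin k) ℂ} {p : ℂ} (hp : p ≠ 0) (hA : evalAt A P = p • 1)
    (hk : 1 ≤ k) (n : ℕ) : ∃ i : Fin n → Fin d, ((List.ofFn i).map A).prod ≠ 0 := by
  have : NeZero k := ⟨by omega⟩
  by_contra! hzero
  have hlong : ∀ w : List (Fin d), n ≤ w.length → (w.map A).prod = 0 := by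
    intro w hw
    have h := hzero fun j : Fin n => w.get (Fin.castLE hw j)
    have h' : List.ofFn (fun j : Fin n => w.get (Fin.castLE hw j)) = w.take n := by
      apply List.ext_getElem <;> simp [hw]
    rw [h'] at h
    rw [← List.take_append_drop n w, List.map_append, List.prod_append, h, zero_mul]
  have hind : ∀ t : ℕ, ∃ w : List (Fin d), t ≤ w.length ∧ (w.map A).prod ≠ 0 := by
    intro t
    induction t with
    | zero => exact ⟨[], le_rfl, by simp⟩
    | succ t ih =>
      obtain ⟨w, hw, hw0⟩ := ih
      by_contra! hall
      apply hw0
      have h1 : (w.map A).prod * evalAt A P = 0 := by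
        rw [hP.evalAt_eq_sum, Finset.mul_sum]
        refine Finset.sum_eq_zero fun i _ => ?_
        have := hall (w ++ List.ofFn i) (by simp; omega)
        rw [List.map_append, List.prod_append, List.map_ofFn] at this
        rw [mul_smul_comm]
        erw [this]
        simp
      rw [hA, mul_smul_comm, mul_one] at h1
      exact (smul_eq_zero.mp h1).resolve_left hp
  obtain ⟨w, hw, hw0⟩ := hind n
  exact hw0 (hlong w hw)

lemma insertState_ne_zero {d m s r : ℕ} {χ : Chain d m} {ψ : Chain d (s + r)} (hχ : χ ≠ 0)
    (hψ : ψ ≠ 0) : insertState s r χ ψ ≠ 0 := by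
  obtain ⟨v, hv⟩ : ∃ v, χ v ≠ 0 := by
    by_contra! h
    exact hχ (by ext v; exact h v)
  obtain ⟨u, hu⟩ : ∃ u, ψ u ≠ 0 := by
    by_contra! h
    exact hψ (by ext v; exact h v)
  intro h0
  let i : Fin (s + m + r) → Fin d :=
    Fin.append (Fin.append (fun j => u (Fin.castAdd r j)) v) fun j => u (Fin.natAdd s j)
  have hm : midPart i = v := by ext j; simp [i, midPart]
  have hu' : Fin.append (leftPart i) (rightPart i) = u := by
    ext j
    refine Fin.addCases (fun j => ?_) (fun j => ?_) j <;> simp [i, leftPart, rightPart]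
  have h1 : χ (midPart i) * ψ (Fin.append (leftPart i) (rightPart i)) = 0 :=
    congrArg (fun x : Chain d (s + m + r) => x i) h0
  rw [hm, hu'] at h1
  exact mul_ne_zero hv hu h1

lemma exists_actAt_ne_zero {d D m : ℕ} (hD : 1 ≤ D) (hm : 1 ≤ m)
    (hQ : Nontrivial (CentralQuotient d D m)) (c : CutGlueData d D m) (s r : ℕ) :
    ∃ (ω : Matrix (Fin D) (Fin D) ℂ) (A : Fin d → Matrix (Fin D) (Fin D) ℂ),
      actAt s r c.op (mps ω A (s + m + r)) ≠ 0 := by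
  obtain ⟨j⟩ : Nonempty (Fin c.N) := c.basis.index_nonempty
  have hnot : ¬ IsMPI D (c.P j : NCPoly d) := by
    intro h
    apply c.basis.ne_zero j
    rw [← c.mk_P, Submodule.Quotient.mk_eq_zero]
    exact ⟨(c.P j).2.1, h⟩
  simp only [IsMPI, not_forall] at hnot
  obtain ⟨k, hk, A, hA⟩ := hnot
  obtain rfl : k = D := by
    by_contra hne
    exact hA (evalAt_eq_zero_of_lt hm (c.P j).2.1 (c.P j).2.2 (lt_of_le_of_ne hk hne) A)
  choose p hp using fun i => (c.P i).2.2 A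
  have hpj : p j ≠ 0 := by
    intro h
    exact hA (by rw [hp j, h, zero_smul])
  obtain ⟨u, hu⟩ := exists_word_ne_zero (c.P j).2.1 hm hpj (hp j) hD (s + r)
  obtain ⟨a, b, hab⟩ : ∃ a b, ((List.ofFn u).map A).prod a b ≠ 0 := by
    by_contra! h
    exact hu (by ext a b; exact h a b)
  -- This matrix unit makes the trace pick out the nonzero entry `(a, b)` of the word `u`.
  refine ⟨Matrix.single b a 1, A, ?_⟩
  rw [actAt_op_mps c A p hp]
  apply insertState_ne_zero
  · intro h
    exact hpj (Fintype.linearIndependent_iff.mp c.orthonormal.linearIndependent p h j)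
  · intro h
    have h1 : mps (Matrix.single b a 1) A (s + r) u = 0 := by rw [h]; rfl
    rw [mps_apply, Matrix.trace_single_mul] at h1
    exact hab (by simpa using h1)

/-! ### A central polynomial in two variables -/

/-- The noncommutative polynomial
`∑_{σ, τ} sgn σ sgn τ ∏_j X^{σ j} Y X^{τ j}` with `σ`, `τ` running over the permutations of `D`
letters. -/
noncomputable def doubleVandermonde {d : ℕ} (D : ℕ) (x y : Fin d) : NCPoly d :=
  ∑ σ : Perm (Fin D), ∑ τ : Perm (Fin D), ((Perm.sign σ : ℤ) * (Perm.sign τ : ℤ) : ℂ) •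
    monomial (List.ofFn fun j : Fin D =>
      List.replicate (σ j).val x ++ y :: List.replicate (τ j).val x).flatten

lemma isHomogeneous_doubleVandermonde {d : ℕ} (D : ℕ) (x y : Fin d) :
    IsHomogeneous (D * D) (doubleVandermonde D x y) := by
  intro w hw
  simp only [doubleVandermonde, map_sum, map_smul]
  refine Finset.sum_eq_zero fun σ _ => Finset.sum_eq_zero fun τ _ => ?_
  rw [isHomogeneous_monomial _ w, smul_zero]
  refine fun h => hw (h.trans ?_)
  have h1 : ∑ j, (σ j).val = ∑ j : Fin D, j.val := Equiv.sum_comp σ fun j => j.val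
  have h2 : ∑ j, (τ j).val = ∑ j : Fin D, j.val := Equiv.sum_comp τ fun j => j.val
  have h3 : (∑ j : Fin D, j.val) * 2 = D * (D - 1) := by
    rw [Fin.sum_univ_eq_sum_range (fun i => i), Finset.sum_range_id_mul_two]
  rw [List.length_flatten, List.map_ofFn, List.sum_ofFn]
  simp only [Function.comp_apply, List.length_append, List.length_cons, List.length_replicate,
    Finset.sum_add_distrib, h1, h2]
  simp
  rcases D with _ | n
  · simp
  · simp at h3 ⊢
    nlinarith

lemma evalAt_doubleVandermonde {d k : ℕ} (D : ℕ) (x y : Fin d)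
    (A : Fin d → Matrix (Fin k) (Fin k) ℂ) :
    evalAt A (doubleVandermonde D x y) =
      ∑ σ : Perm (Fin D), ∑ τ : Perm (Fin D), ((Perm.sign σ : ℤ) * (Perm.sign τ : ℤ) : ℂ) •
        (List.ofFn fun j : Fin D => A x ^ (σ j).val * A y * A x ^ (τ j).val).prod := by
  simp only [doubleVandermonde, map_sum, map_smul, evalAt_monomial, List.map_flatten,
    List.prod_flatten, List.map_ofFn]
  simp [Function.comp_def, Matrix.mul_assoc]

/-- An entry of a product of matrices as a sum over paths. -/
lemma prod_ofFn_apply {ι R : Type*} [Fintype ι] [DecidableEq ι] [CommSemiring R] {n : ℕ}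
    (M : Fin n → Matrix ι ι R) (a b : ι) :
    (List.ofFn M).prod a b = ∑ p : Fin (n + 1) → ι,
      if p 0 = a ∧ p (Fin.last n) = b then ∏ j, M j (p j.castSucc) (p j.succ) else 0 := by
  induction n generalizing a with
  | zero =>
    rw [← (Equiv.funUnique (Fin 1) ι).symm.sum_comp]
    simp [Matrix.one_apply, ite_and]
  | succ n ih =>
    rw [List.ofFn_succ, List.prod_cons, Matrix.mul_apply, ← (Fin.consEquiv fun _ => ι).sum_comp,
      Fintype.sum_prod_type]
    trans ∑ q : Fin (n + 1) → ι, if q (Fin.last n) = b then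
      M 0 a (q 0) * ∏ j : Fin n, M j.succ (q j.castSucc) (q j.succ) else 0
    · simp only [ih, Finset.mul_sum]
      rw [Finset.sum_comm]
      refine Finset.sum_congr rfl fun q _ => ?_
      rw [Finset.sum_eq_single (q 0)]
      · simp
      · intro c _ hc
        simp [hc.symm]
      · simp
    · rw [Finset.sum_eq_single a]
      · refine Finset.sum_congr rfl fun q _ => ?_
        simp [Fin.consEquiv, Fin.prod_univ_succ, ← Fin.succ_last]
      · intro c _ hc
        simp [Fin.consEquiv, hc]
      · simp

lemma sum_sign_smul_path (D : ℕ) (u v : Fin D → ℂ) :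
    ∑ σ : Perm (Fin D), ∑ τ : Perm (Fin D), ((Perm.sign σ : ℤ) * (Perm.sign τ : ℤ) : ℂ) *
      ((∏ j, u j ^ (σ j).val) * ∏ j, v j ^ (τ j).val) =
      (vandermonde u).det * (vandermonde v).det := by
  have h : ∀ w : Fin D → ℂ, (vandermonde w).det =
      ∑ σ : Perm (Fin D), ((Perm.sign σ : ℤ) : ℂ) * ∏ j, w j ^ (σ j).val := by
    intro w
    rw [← Matrix.det_transpose, Matrix.det_apply']
    rfl
  rw [h, h, Finset.sum_mul_sum]
  exact Finset.sum_congr rfl fun σ _ => Finset.sum_congr rfl fun τ _ => by ring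

/-- Along a fixed path, step `j` carries `t ^ σ j` at its source and `t ^ τ j` at its target, so the
signed sums over `σ` and `τ` separate into two determinants. -/
lemma evalAt_doubleVandermonde_diagonal {d k : ℕ} (D : ℕ) (x y : Fin d)
    (A : Fin d → Matrix (Fin k) (Fin k) ℂ) (t : Fin k → ℂ) (hx : A x = diagonal t) (a b : Fin k) :
    evalAt A (doubleVandermonde D x y) a b = ∑ p : Fin (D + 1) → Fin k,
      if p 0 = a ∧ p (Fin.last D) = b then
        (∏ j : Fin D, A y (p j.castSucc) (p j.succ)) *
          ((vandermonde fun j : Fin D => t (p j.castSucc)).det *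
            (vandermonde fun j : Fin D => t (p j.succ)).det) else 0 := by
  simp only [evalAt_doubleVandermonde, Matrix.sum_apply, Matrix.smul_apply, prod_ofFn_apply,
    Finset.smul_sum]
  rw [Finset.sum_congr rfl fun σ _ => Finset.sum_comm, Finset.sum_comm]
  refine Finset.sum_congr rfl fun p _ => ?_
  split_ifs with h
  · rw [← sum_sign_smul_path, Finset.mul_sum]
    refine Finset.sum_congr rfl fun σ _ => ?_
    rw [Finset.mul_sum]
    refine Finset.sum_congr rfl fun τ _ => ?_
    simp only [hx, Matrix.diagonal_pow, Matrix.mul_diagonal, Matrix.diagonal_mul, Pi.pow_apply,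
      Finset.prod_mul_distrib, smul_eq_mul]
    ring
  · simp

/-- The sum of the cyclic products of the entries of `B` along the Hamiltonian cycles
through `a`. -/
noncomputable def cycleSum {n : ℕ} (B : Matrix (Fin (n + 1)) (Fin (n + 1)) ℂ) (a : Fin (n + 1)) :
    ℂ :=
  ∑ σ : Perm (Fin (n + 1)), if σ 0 = a then ∏ j, B (σ j) (σ (j + 1)) else 0

/-- Shifting the starting point of a cycle to `b` permutes the factors of its product cyclically. -/
lemma cycleSum_eq {n : ℕ} (B : Matrix (Fin (n + 1)) (Fin (n + 1)) ℂ) (a b : Fin (n + 1)) :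
    cycleSum B a = cycleSum B b := by
  simp only [cycleSum, ← Finset.sum_filter]
  refine Finset.sum_bij' (fun σ _ => (Equiv.addRight (σ.symm b)).trans σ)
    (fun σ _ => (Equiv.addRight (σ.symm a)).trans σ) ?_ ?_ ?_ ?_ ?_
  · simp
  · simp
  · intro σ hσ
    obtain rfl : σ 0 = a := by simpa using hσ
    ext j
    simp
  · intro σ hσ
    obtain rfl : σ 0 = b := by simpa using hσ
    ext j
    simp
  · intro σ _
    simp only [Equiv.trans_apply, Equiv.coe_addRight]
    rw [← Equiv.prod_comp (Equiv.addRight (σ.symm b)) fun j => B (σ j) (σ (j + 1))]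
    simp [add_right_comm]

/-- The first `n + 1` vertices exhaust `Fin (n + 1)`, so the last vertex repeats one of them;
repeating any but the first would contradict injectivity of the tail. -/
lemma last_eq_zero_of_injective {n : ℕ} {p : Fin (n + 2) → Fin (n + 1)}
    (h1 : Function.Injective fun j : Fin (n + 1) => p j.castSucc)
    (h2 : Function.Injective fun j : Fin (n + 1) => p j.succ) : p (Fin.last (n + 1)) = p 0 := by
  obtain ⟨j, hj⟩ := (Finite.injective_iff_surjective.mp h1) (p (Fin.last (n + 1)))
  rcases Fin.eq_zero_or_eq_succ j with rfl | ⟨j, rfl⟩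
  · exact hj.symm
  · have h3 : j.castSucc = Fin.last n := by
      apply h2
      change p j.castSucc.succ = p (Fin.last n).succ
      rw [Fin.succ_last, ← hj, Fin.succ_castSucc]
    exact absurd h3 (Fin.castSucc_lt_last j).ne

lemma evalAt_doubleVandermonde_of_diagonal {d n : ℕ} (x y : Fin d)
    (A : Fin d → Matrix (Fin (n + 1)) (Fin (n + 1)) ℂ) (t : Fin (n + 1) → ℂ)
    (hx : A x = diagonal t) :
    evalAt A (doubleVandermonde (n + 1) x y) =
      (((Perm.sign (finRotate (n + 1)) : ℤ) : ℂ) * (vandermonde t).det ^ 2 * cycleSum (A y) 0) •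
        1 := by
  have hV : ∀ q : Fin (n + 1) → Fin (n + 1), (vandermonde fun j => t (q j)).det ≠ 0 →
      Function.Injective q := by
    intro q hq
    exact Function.Injective.of_comp (f := t) (det_vandermonde_ne_zero_iff.mp hq)
  have hperm : ∀ σ : Perm (Fin (n + 1)), (vandermonde fun j => t (σ j)).det =
      ((Perm.sign σ : ℤ) : ℂ) * (vandermonde t).det := fun σ =>
    Matrix.det_permute σ (vandermonde t)
  ext a b
  rw [evalAt_doubleVandermonde_diagonal (n + 1) x y A t hx, Matrix.smul_apply, Matrix.one_apply]
  by_cases hab : a = b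
  · subst hab
    rw [if_pos rfl, cycleSum_eq _ 0 a, cycleSum, smul_eq_mul, mul_one, Finset.mul_sum]
    symm
    -- A permutation `σ` becomes the closed path `σ 0, …, σ n, σ 0`; every other path has weight
    -- zero.
    refine Finset.sum_of_injOn
      (fun σ : Perm (Fin (n + 1)) => (Fin.snoc σ (σ 0) : Fin (n + 2) → Fin (n + 1))) ?_ ?_ ?_ ?_
    · intro σ _ τ _ h
      ext j
      have := congrFun h j.castSucc
      simpa using congrArg Fin.val this
    · simp
    · intro p _ hp
      by_contra hne
      rw [ite_eq_right_iff, Classical.not_imp] at hne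
      obtain ⟨⟨h0, hl⟩, hne⟩ := hne
      have h1 := hV _ (left_ne_zero_of_mul (right_ne_zero_of_mul hne))
      apply hp
      refine ⟨Equiv.ofBijective _ (Finite.injective_iff_bijective.mp h1), by simp, ?_⟩
      ext j
      refine Fin.lastCases ?_ (fun j => ?_) j
      · simp [h0, hl]
      · simp
    · intro σ _
      have hs : ∀ j : Fin (n + 1),
          (Fin.snoc σ (σ 0) : Fin (n + 2) → Fin (n + 1)) j.succ = σ (j + 1) := by
        intro j
        refine Fin.lastCases ?_ (fun j => ?_) j
        · simp [Fin.succ_last]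
        · rw [Fin.succ_castSucc, Fin.snoc_castSucc, Fin.coeSucc_eq_succ]
      have h0 : (Fin.snoc σ (σ 0) : Fin (n + 2) → Fin (n + 1)) 0 = σ 0 :=
        Fin.snoc_castSucc (α := fun _ => Fin (n + 1)) (σ 0) σ 0
      have hrot : (vandermonde fun j => t (σ (j + 1))).det =
          ((Perm.sign σ : ℤ) : ℂ) * ((Perm.sign (finRotate (n + 1)) : ℤ) : ℂ) *
            (vandermonde t).det := by
        have := hperm ((finRotate (n + 1)).trans σ)
        simpa [finRotate_apply, Perm.sign_trans] using this
      have hsq : ((Perm.sign σ : ℤ) : ℂ) * ((Perm.sign σ : ℤ) : ℂ) = 1 := by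
        rw [← Int.cast_mul, ← Units.val_mul, Int.units_mul_self]; simp
      simp only [h0, Fin.snoc_last, and_self, Fin.snoc_castSucc, hs, hperm, hrot]
      split_ifs
      -- The sign of `σ` occurs in both determinants and squares to one; only the sign of the
      -- rotation remains.
      · linear_combination ((∏ j, A y (σ j) (σ (j + 1))) *
          ((Perm.sign (finRotate (n + 1)) : ℤ) : ℂ) * (vandermonde t).det ^ 2) * (-hsq)
      · simp
  · rw [if_neg hab, smul_zero]
    refine Finset.sum_eq_zero fun p _ => ?_
    by_contra hne
    rw [ite_eq_right_iff, Classical.not_imp] at hne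
    obtain ⟨⟨h0, hl⟩, hne⟩ := hne
    have h1 := hV _ (left_ne_zero_of_mul (right_ne_zero_of_mul hne))
    have h2 := hV _ (right_ne_zero_of_mul (right_ne_zero_of_mul hne))
    exact hab (h0.symm.trans ((last_eq_zero_of_injective h1 h2).symm.trans hl))

/-! ### Density of the matrices with distinct eigenvalues -/

/-- Over `ℂ` a separable characteristic polynomial has `D` distinct roots; the columns of `S` are
corresponding eigenvectors. -/
lemma exists_diagonalization {D : ℕ} (M : Matrix (Fin D) (Fin D) ℂ) (hM : M.charpoly.Separable) :
    ∃ (S : Matrix (Fin D) (Fin D) ℂ) (t : Fin D → ℂ), IsUnit S ∧ S * diagonal t = M * S := by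
  have hcard : M.charpoly.roots.toFinset.card = D := by
    rw [Multiset.toFinset_card_of_nodup (Polynomial.nodup_roots hM),
      ← (IsAlgClosed.splits M.charpoly).natDegree_eq_card_roots, Matrix.charpoly_natDegree_eq_dim,
      Fintype.card_fin]
  let e := (Finset.equivFinOfCardEq hcard).symm
  have hev : ∀ i, ∃ v, Module.End.HasEigenvector (toLin' M) (e i : ℂ) v := by
    intro i
    refine Module.End.HasEigenvalue.exists_hasEigenvector ?_
    rw [Module.End.hasEigenvalue_iff_isRoot_charpoly, Matrix.charpoly_toLin']
    exact Polynomial.isRoot_of_mem_roots (Multiset.mem_toFinset.mp (e i).2)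
  choose v hv using hev
  have hli := Module.End.eigenvectors_linearIndependent' (toLin' M) (fun i => (e i : ℂ))
    (Subtype.val_injective.comp e.injective) v hv
  refine ⟨(Matrix.of v)ᵀ, fun i => e i, ?_, ?_⟩
  · rw [Matrix.isUnit_transpose]
    exact Matrix.linearIndependent_rows_iff_isUnit.mp hli
  · ext i j
    have := congrFun (hv j).apply_eq_smul i
    rw [Matrix.mul_diagonal, Matrix.mul_apply]
    simpa [Matrix.mulVec, dotProduct, mul_comm] using this.symm

open Polynomial in
-- On the line from `M` to a diagonal matrix with distinct entries, the resultant of the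
-- characteristic polynomial and its derivative is a polynomial in `s`. It is nonzero at `s = 1`, so
-- its roots are finite in number and stay away from a punctured neighbourhood of `0`.
lemma eventually_separable_charpoly {D : ℕ} (M : Matrix (Fin D) (Fin D) ℂ) :
    ∀ᶠ s : ℂ in nhdsWithin 0 {0}ᶜ,
      (M + s • (diagonal (fun i : Fin D => (i.val : ℂ)) - M)).charpoly.Separable := by
  set N := diagonal (fun i : Fin D => (i.val : ℂ)) with hN
  let L : Matrix (Fin D) (Fin D) ℂ[X] := M.map C + (X : ℂ[X]) • (N - M).map C
  have hL : ∀ s : ℂ, L.map (evalRingHom s) = M + s • (N - M) := by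
    intro s
    ext i j
    simp [L]
  -- Explicit degrees `D` and `D - 1` let the resultant commute with evaluation at `s`.
  let R : ℂ[X] := resultant L.charpoly L.charpoly.derivative D (D - 1)
  have hR : ∀ s : ℂ, (M + s • (N - M)).charpoly.Separable ↔ R.eval s ≠ 0 := by
    intro s
    set f := (M + s • (N - M)).charpoly with hf
    have hdeg : f.natDegree = D := by rw [Matrix.charpoly_natDegree_eq_dim, Fintype.card_fin]
    have h1 : R.eval s = resultant f f.derivative := by
      change evalRingHom s R = _
      rw [natDegree_derivative, hdeg, ← resultant_map_map, ← derivative_map, hf, ← hL s,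
        Matrix.charpoly_map]
    rw [h1, separable_def, ← isUnit_resultant_iff_isCoprime (Matrix.charpoly_monic _),
      isUnit_iff_ne_zero]
  have hR0 : R ≠ 0 := by
    intro h
    have h1 : (M + (1 : ℂ) • (N - M)).charpoly.Separable := by
      have : M + (1 : ℂ) • (N - M) = N := by simp
      rw [this, hN, Matrix.charpoly_diagonal]
      apply separable_prod_X_sub_C_iff.mpr
      intro i j hij
      exact Fin.ext (Nat.cast_injective (R := ℂ) hij)
    exact (hR 1).mp h1 (by simp [h])
  have hfin : (({s | R.eval s = 0} \ {0} : Set ℂ)).Finite :=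
    ((Polynomial.finite_setOfPred_isRoot hR0)).subset fun s hs => hs.1
  have h0 : (({s | R.eval s = 0} \ {0} : Set ℂ))ᶜ ∈ nhds (0 : ℂ) :=
    hfin.isClosed.isOpen_compl.mem_nhds (by simp)
  filter_upwards [mem_nhdsWithin_of_mem_nhds h0, self_mem_nhdsWithin] with s hs hs0
  exact (hR s).mpr fun h => hs ⟨h, hs0⟩

lemma continuous_evalAt {d k : ℕ} {T : Type*} [TopologicalSpace T]
    {A : T → Fin d → Matrix (Fin k) (Fin k) ℂ} (hA : ∀ i, Continuous fun s => A s i)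
    (P : NCPoly d) : Continuous fun s => evalAt (A s) P := by
  induction P using FreeAlgebra.induction with
  | grade0 r => simpa using continuous_const
  | grade1 x => simpa using hA x
  | mul a b ha hb => simpa using ha.matrix_mul hb
  | add a b ha hb => simpa [Pi.add_def] using ha.add hb

lemma isCentral_doubleVandermonde {d n : ℕ} {x y : Fin d} (hxy : x ≠ y) :
    IsCentral (n + 1) (doubleVandermonde (n + 1) x y) := by
  intro A
  set P := doubleVandermonde (n + 1) x y
  let K : Submodule ℂ (Matrix (Fin (n + 1)) (Fin (n + 1)) ℂ) := Submodule.span ℂ {1}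
  suffices h : evalAt A P ∈ K by
    obtain ⟨c, hc⟩ := Submodule.mem_span_singleton.mp h
    exact ⟨c, hc.symm⟩
  -- Only the `x` entry needs perturbing; the scalar matrices form a closed set, so membership
  -- passes to the limit `s → 0`.
  let B : ℂ → Fin d → Matrix (Fin (n + 1)) (Fin (n + 1)) ℂ := fun s =>
    Function.update A x (A x + s • (diagonal (fun i : Fin (n + 1) => (i.val : ℂ)) - A x))
  have hB0 : B 0 = A := by simp [B]
  have hcont : Continuous fun s => evalAt (B s) P := by
    apply continuous_evalAt
    intro i
    by_cases hi : i = x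
    · subst hi
      simp only [B, Function.update_self]
      fun_prop
    · simpa [B, hi] using continuous_const
  have hclosed : IsClosed (K : Set (Matrix (Fin (n + 1)) (Fin (n + 1)) ℂ)) :=
    K.closed_of_finiteDimensional
  rw [← hB0]
  refine hclosed.mem_of_tendsto (b := nhdsWithin (0 : ℂ) {0}ᶜ)
    (hcont.continuousAt.tendsto.mono_left nhdsWithin_le_nhds) ?_
  filter_upwards [eventually_separable_charpoly (A x)] with s hs
  obtain ⟨S, t, hS, hSt⟩ := exists_diagonalization _ hs
  have hdet := (Matrix.isUnit_iff_isUnit_det _).mp hS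
  let A' : Fin d → Matrix (Fin (n + 1)) (Fin (n + 1)) ℂ :=
    Function.update (fun i => S⁻¹ * B s i * S) x (diagonal t)
  have h1 : S * evalAt A' P = evalAt (B s) P * S := by
    apply mul_evalAt_of_intertwine
    intro i
    by_cases hi : i = x
    · subst hi
      simpa [A', B] using hSt
    · simp only [A', Function.update_of_ne hi]
      rw [← Matrix.mul_assoc, Matrix.mul_nonsing_inv_cancel_left _ _ hdet]
  rw [evalAt_doubleVandermonde_of_diagonal x y A' t (by simp [A'])] at h1
  have h2 := congrArg (· * S⁻¹) h1
  simp only [Matrix.mul_smul, Matrix.mul_one, Matrix.smul_mul, Matrix.mul_nonsing_inv _ hdet,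
    Matrix.mul_nonsing_inv_cancel_right _ _ hdet] at h2
  exact Submodule.mem_span_singleton.mpr ⟨_, h2⟩

lemma cycleSum_ones_ne_zero (n : ℕ) :
    cycleSum (Matrix.of fun _ _ : Fin (n + 1) => (1 : ℂ)) 0 ≠ 0 := by
  simp only [cycleSum, Matrix.of_apply, Finset.prod_const_one, Finset.sum_boole]
  rw [Nat.cast_ne_zero, Finset.card_ne_zero]
  exact ⟨1, by simp⟩

lemma not_isMPI_doubleVandermonde {d n : ℕ} {x y : Fin d} (hxy : x ≠ y) :
    ¬ IsMPI (n + 1) (doubleVandermonde (n + 1) x y) := by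
  intro h
  let t : Fin (n + 1) → ℂ := fun i => i.val
  -- Distinct eigenvalues for `X` keep the Vandermonde factor nonzero, and the all-ones `Y` makes
  -- each Hamiltonian cycle contribute `1`.
  let A : Fin d → Matrix (Fin (n + 1)) (Fin (n + 1)) ℂ :=
    Function.update (fun _ => Matrix.of fun _ _ => 1) x (diagonal t)
  have h1 := h (n + 1) le_rfl A
  rw [evalAt_doubleVandermonde_of_diagonal x y A t (by simp [A])] at h1
  have hy : A y = Matrix.of fun _ _ => 1 := by simp [A, hxy.symm]
  have hV : (vandermonde t).det ≠ 0 := by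
    rw [det_vandermonde_ne_zero_iff]
    intro i j hij
    exact Fin.ext (Nat.cast_injective (R := ℂ) hij)
  have hsign : ((Perm.sign (finRotate (n + 1)) : ℤ) : ℂ) ≠ 0 := by
    exact_mod_cast (Perm.sign (finRotate (n + 1))).ne_zero
  rw [hy] at h1
  exact smul_ne_zero (mul_ne_zero (mul_ne_zero hsign (pow_ne_zero 2 hV))
    (cycleSum_ones_ne_zero n)) one_ne_zero h1

lemma exists_nontrivial_centralQuotient {d D : ℕ} (hd : 2 ≤ d) (hD : 1 ≤ D) :
    ∃ m : ℕ, 1 ≤ m ∧ Nontrivial (CentralQuotient d D m) := by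
  obtain ⟨n, rfl⟩ := Nat.exists_eq_add_of_le' hD
  have hxy : (⟨0, by omega⟩ : Fin d) ≠ ⟨1, by omega⟩ := by simp
  refine ⟨(n + 1) * (n + 1), Nat.mul_pos n.succ_pos n.succ_pos, ?_⟩
  refine ⟨Submodule.Quotient.mk ⟨_, isHomogeneous_doubleVandermonde _ _ _,
    isCentral_doubleVandermonde hxy⟩, 0, ?_⟩
  rw [Ne, Submodule.Quotient.mk_eq_zero]
  exact fun h => not_isMPI_doubleVandermonde hxy h.2

end CutGlue

theorem mainTheorem3 (d D : ℕ) (hD : 1 ≤ D) :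
    -- the construction can be carried out in every degree
    (∀ m : ℕ, Nonempty (CutGlue.CutGlueData d D m)) ∧
    -- every operator so constructed cuts and glues every MPS of bond dimension at most `D`
    (∀ (m : ℕ) (c : CutGlue.CutGlueData d D m), ∀ k ≤ D,
      ∀ A : Fin d → Matrix (Fin k) (Fin k) ℂ, ∃ p : Fin c.N → ℂ,
        (∀ i, CutGlue.evalAt A (c.P i : CutGlue.NCPoly d) = p i • 1) ∧
        ∀ (s r : ℕ) (ω : Matrix (Fin k) (Fin k) ℂ),
          CutGlue.actAt s r c.op (CutGlue.mps ω A (s + m + r)) =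
            CutGlue.insertState s r (∑ i, p i • c.φ i) (CutGlue.mps ω A (s + r))) ∧
    -- if the quotient space is not zero, the operator does not annihilate all MPS
    (∀ m : ℕ, 1 ≤ m → Nontrivial (CutGlue.CentralQuotient d D m) →
      ∀ (c : CutGlue.CutGlueData d D m) (s r : ℕ),
        ∃ (ω : Matrix (Fin D) (Fin D) ℂ) (A : Fin d → Matrix (Fin D) (Fin D) ℂ),
          CutGlue.actAt s r c.op (CutGlue.mps ω A (s + m + r)) ≠ 0) ∧
    -- the quotient space is not zero in some positive degree
    (2 ≤ d → ∃ m : ℕ, 1 ≤ m ∧ Nontrivial (CutGlue.CentralQuotient d D m)) := by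
  refine ⟨fun m => CutGlue.nonempty_cutGlueData d D m, fun m c k hk A => ?_,
    fun m hm hQ c s r => CutGlue.exists_actAt_ne_zero hD hm hQ c s r,
    fun hd => CutGlue.exists_nontrivial_centralQuotient hd hD⟩
  choose p hp using fun i => (c.P i).2.2.evalAt_eq_smul hk A
  exact ⟨p, hp, fun s r ω => CutGlue.actAt_op_mps c A p hp s r ω⟩
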